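/- Let $d\ge 1$, $\kappa>0$, $R>0$ and $Q_R=[-R,R]^d$. Let $(X_t)_{t\ge 0}$ be the continuous-time simple random walk on $\mathbb{Z}^d$ that jumps across every nearest-neighbour bond at rate $\kappa$ (generator $(Af)(x)=\kappa\sum_{y\sim x}(f(y)-f(x))$), started at $0$ under $\mathbb{P}_0$ with expectation $\mathbb{E}_0$, and let $\ell_T(z)=\int_0^T \mathbf{1}_{\{X_s=z\}}\,ds$ be its local times. Let $T\mapsto\alpha_T$ satisfy $1\ll\alpha_T\ll (T/\log T)^{1/(d+2)}$ as $T\to\infty$, and put $$L_T(x)=\frac{\alpha_T^d}{T}\,\ell_T(\lfloor\alpha_T x\rfloor),\qquad x\in\mathbb{R}^d,$$ with the floor taken coordinatewise. Let $M_1(Q_R)$ be the set of all probability densities on $Q_R$, as a subset of $L^1(Q_R)$ with its Borel $\sigma$-algebra, and let $F:M_1(Q_R)\to\mathbb{R}$ be measurable. Define $$\chi=\inf\Big\{\tfrac12\|\nabla g\|_2^2-F(g^2)\;:\;g\in H^1(\mathbb{R}^d),\ \|g\|_2=1,\ \operatorname{supp}(g)\subseteq Q_R\Big\}\in[-\infty,\infty).$$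 Assume that $$\liminf_{T\to\infty}\ \inf_{\mu}\Big(\alpha_T^2\,\frac{\kappa}{2}\sum_{x\sim y}\big(\sqrt{\mu(x)}-\sqrt{\mu(y)}\big)^2-F\big(\alpha_T^d\,\mu(\lfloor\alpha_T\,\cdot\,\rfloor)\big)\Big)\ \ge\ \chi ,$$ where the sum is over ordered pairs of nearest neighbours $x,y\in\mathbb{Z}^d$ and the infimum is over all probability measures $\mu$ on $\mathbb{Z}^d$ for which the step function $\alpha_T^d\,\mu(\lfloor\alpha_T\,\cdot\,\rfloor)$ is supported in $Q_R$. Then $$\limsup_{T\to\infty}\frac{\alpha_T^2}{T}\log\mathbb{E}_0\Big[\exp\Big\{\frac{T}{\alpha_T^2}F(L_T)\Big\}\mathbf{1}_{\{\operatorname{supp}(L_T)\subseteq Q_R\}}\Big]\le-\chi .$$ (The expectation and the infima may be infinite; all quantities are taken in $[-\infty,\infty]$.) -/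

import Mathlib

open MeasureTheory Filter Topology Asymptotics
open scoped ENNReal

noncomputable section

namespace RescaledLocalTimes

/-! ### Continuous-time simple random walk on `ℤ^d`, started at the origin -/

/-- The `2d` unit vectors `± e_i` of `ℤ^d`, indexed by direction and sign. -/
def unitStep {d : ℕ} (s : Fin d × Bool) : Fin d → ℤ :=
  Pi.single s.1 (if s.2 then 1 else -1)

/-- The law of the sequence (step, holding time): the pairs are independent and identically
distributed, the step is uniform among the `2d` unit vectors, and the holding time is exponential
with parameter `2dκ` and independent of the step. -/
def walkLaw (d : ℕ) [NeZero d] (κ : ℝ) : Measure (ℕ → (Fin d × Bool) × ℝ) :=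
  Measure.infinitePi fun _ =>
    (PMF.uniformOfFintype (Fin d × Bool)).toMeasure.prod
      (ProbabilityTheory.expMeasure (2 * d * κ))

lemma isProbabilityMeasure_walkLaw (d : ℕ) [NeZero d] {κ : ℝ} (hκ : 0 < κ) :
    IsProbabilityMeasure (walkLaw d κ) := by
  have hd : (0 : ℝ) < d := by exact_mod_cast Nat.pos_of_ne_zero (NeZero.ne d)
  have := ProbabilityTheory.isProbabilityMeasure_expMeasure (r := 2 * d * κ) (by positivity)
  unfold walkLaw
  infer_instance

/-- The site occupied after `n` jumps. -/
def jumpChain {d : ℕ} (ω : ℕ → (Fin d × Bool) × ℝ) (n : ℕ) : Fin d → ℤ :=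
  ∑ k ∈ Finset.range n, unitStep (ω k).1

/-- The time of the `n`-th jump (with `jumpTime ω 0 = 0`). -/
def jumpTime {d : ℕ} (ω : ℕ → (Fin d × Bool) × ℝ) (n : ℕ) : ℝ :=
  ∑ k ∈ Finset.range n, (ω k).2

/-- The number of jumps up to time `t`. -/
def jumpCount {d : ℕ} (ω : ℕ → (Fin d × Bool) × ℝ) (t : ℝ) : ℕ :=
  sSup {n : ℕ | jumpTime ω n ≤ t}

/-- The position `X_t`. Under `walkLaw d κ` this is the continuous-time Markov chain on `ℤ^d`
started at `0` that jumps across each nearest-neighbour bond at rate `κ`, i.e. whose generator is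
`(A f)(x) = κ ∑_{y ∼ x} (f y - f x)`. -/
def walk {d : ℕ} (ω : ℕ → (Fin d × Bool) × ℝ) (t : ℝ) : Fin d → ℤ :=
  jumpChain ω (jumpCount ω t)

open Classical in
/-- The local time `ℓ_T(z) = ∫_0^T 1{X_s = z} ds`. -/
def localTime {d : ℕ} (ω : ℕ → (Fin d × Bool) × ℝ) (T : ℝ) (z : Fin d → ℤ) : ℝ :=
  ∫ s in (0 : ℝ)..T, if walk ω s = z then 1 else 0

/-! ### Rescaling -/

/-- The step function `x ↦ a^d μ(⌊a x⌋)` on `ℝ^d`, the floor being taken coordinatewise. -/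
def rescale {d : ℕ} (a : ℝ) (μ : (Fin d → ℤ) → ℝ) (x : Fin d → ℝ) : ℝ :=
  a ^ d * μ (fun i => ⌊a * x i⌋)

/-- The rescaled local times `L_T(x) = (a^d / T) ℓ_T(⌊a x⌋)`. -/
def rescaledLocalTime {d : ℕ} (a T : ℝ) (ω : ℕ → (Fin d × Bool) × ℝ) : (Fin d → ℝ) → ℝ :=
  rescale a fun z => localTime ω T z / T

/-! ### Probability densities on the cube -/

/-- The cube `[-R, R]^d`. -/
def cube (d : ℕ) (R : ℝ) : Set (Fin d → ℝ) :=
  Set.Icc (fun _ => -R) (fun _ => R)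

/-- The set of probability densities on the cube `[-R, R]^d`, as a subspace of `L¹`. -/
abbrev ProbDensity (d : ℕ) (R : ℝ) : Type :=
  {f : Lp ℝ 1 ((volume : Measure (Fin d → ℝ)).restrict (cube d R)) //
    0 ≤ f ∧ ∫ x in cube d R, f x = 1}

/-- The function `f` restricts to a probability density on the cube `[-R, R]^d`. -/
def IsDensityOn (d : ℕ) (R : ℝ) (f : (Fin d → ℝ) → ℝ) : Prop :=
  IntegrableOn f (cube d R) ∧ (∀ x, 0 ≤ f x) ∧ ∫ x in cube d R, f x = 1

/-- The element of `ProbDensity d R` represented by a function. -/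
def IsDensityOn.toProbDensity {d : ℕ} {R : ℝ} {f : (Fin d → ℝ) → ℝ} (h : IsDensityOn d R f) :
    ProbDensity d R :=
  ⟨h.1.toL1 f, by
    refine ⟨?_, ?_⟩
    · rw [← Lp.coeFn_nonneg]
      filter_upwards [h.1.coeFn_toL1] with x hx
      rw [hx]
      exact h.2.1 x
    · rw [integral_congr_ae h.1.coeFn_toL1]
      exact h.2.2⟩

open Classical in
/-- `F(f)` for a function `f` that restricts to a probability density on the cube. The value `0`
for other `f` plays no role: see `isDensityOn_rescale`, `isDensityOn_rescaledLocalTime` and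
`IsAdmissible.isDensityOn_sq` below. -/
def evalDensity {d : ℕ} {R : ℝ} (F : ProbDensity d R → ℝ) (f : (Fin d → ℝ) → ℝ) : ℝ :=
  if h : IsDensityOn d R f then F h.toProbDensity else 0

/-! ### The continuous variational problem -/

/-- `h` is the weak `i`-th partial derivative of `g` on `ℝ^d`. -/
def HasWeakPartialDeriv {d : ℕ} (i : Fin d) (g h : (Fin d → ℝ) → ℝ) : Prop :=
  ∀ φ : (Fin d → ℝ) → ℝ, ContDiff ℝ (⊤ : ℕ∞) φ → HasCompactSupport φ →
    ∫ x, g x * fderiv ℝ φ x (Pi.single i 1) = - ∫ x, h x * φ x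

/-- `g ∈ H¹(ℝ^d)` with weak gradient `G`, `‖g‖₂ = 1`, and `g` is supported in `[-R, R]^d`. -/
structure IsAdmissible (d : ℕ) (R : ℝ) (g : (Fin d → ℝ) → ℝ)
    (G : Fin d → (Fin d → ℝ) → ℝ) : Prop where
  memLp : MemLp g 2
  memLp_grad : ∀ i, MemLp (G i) 2
  weakDeriv : ∀ i, HasWeakPartialDeriv i g (G i)
  norm_eq_one : ∫ x, g x ^ 2 = 1
  support : ∀ᵐ x, x ∉ cube d R → g x = 0

/-- `χ = inf {½‖∇g‖₂² - F(g²) : g ∈ H¹(ℝ^d), ‖g‖₂ = 1, supp g ⊆ [-R, R]^d}`. -/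
def chi {d : ℕ} {R : ℝ} (F : ProbDensity d R → ℝ) : EReal :=
  ⨅ (g : (Fin d → ℝ) → ℝ) (G : Fin d → (Fin d → ℝ) → ℝ) (_ : IsAdmissible d R g G),
    (((1 / 2) * ∑ i, ∫ x, G i x ^ 2) - evalDensity F (fun x => g x ^ 2) : ℝ)

/-! ### The discrete variational problem -/

/-- `½ ∑_{x ∼ y} (√μ(x) - √μ(y))²`, the sum over ordered pairs of nearest neighbours in `ℤ^d`
(so each bond contributes its squared difference exactly once). -/
def dirichletForm {d : ℕ} (μ : (Fin d → ℤ) → ℝ) : ℝ :=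
  (1 / 2) * ∑' x : Fin d → ℤ, ∑ s : Fin d × Bool, (√(μ x) - √(μ (x + unitStep s))) ^ 2

/-- `μ` is a probability measure on `ℤ^d` whose rescaled density is supported in `[-R, R]^d`
(so that `μ` lives on a finite sub-box of `[-R a, R a]^d`). -/
structure IsBoxProb (d : ℕ) (R a : ℝ) (μ : (Fin d → ℤ) → ℝ) : Prop where
  nonneg : ∀ z, 0 ≤ μ z
  hasSum : HasSum μ 1
  support : tsupport (rescale a μ) ⊆ cube d R

/-- The infimum over `μ` of `a² κ ½ ∑_{x ∼ y} (√μ(x) - √μ(y))² - F(a^d μ(⌊a ·⌋))`. -/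
def chiDiscrete {d : ℕ} {R : ℝ} (F : ProbDensity d R → ℝ) (κ a : ℝ) : EReal :=
  ⨅ (μ : (Fin d → ℤ) → ℝ) (_ : IsBoxProb d R a μ),
    (a ^ 2 * (κ * dirichletForm μ) - evalDensity F (rescale a μ) : ℝ)

/-! ### The exponential moment -/

open Classical in
/-- `E_0[exp{(T / a²) F(L_T)} 1{supp L_T ⊆ [-R, R]^d}]`, an element of `[0, ∞]`. -/
def expMoment {d : ℕ} [NeZero d] {R : ℝ} (F : ProbDensity d R → ℝ) (κ a T : ℝ) : ℝ≥0∞ :=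
  ∫⁻ ω, (if tsupport (rescaledLocalTime a T ω) ⊆ cube d R then
      ENNReal.ofReal (Real.exp (T / a ^ 2 * evalDensity F (rescaledLocalTime a T ω)))
    else 0) ∂(walkLaw d κ)

/-! ### The functional is only evaluated at genuine probability densities -/

lemma IsAdmissible.isDensityOn_sq {d : ℕ} {R : ℝ} {g : (Fin d → ℝ) → ℝ}
    {G : Fin d → (Fin d → ℝ) → ℝ} (h : IsAdmissible d R g G) :
    IsDensityOn d R fun x => g x ^ 2 := by
  refine ⟨h.memLp.integrable_sq.integrableOn, fun x => sq_nonneg _, ?_⟩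
  rw [setIntegral_eq_integral_of_ae_compl_eq_zero, h.norm_eq_one]
  filter_upwards [h.support] with x hx hx'
  simp [hx hx']

lemma measurable_cell {d : ℕ} (a : ℝ) :
    Measurable fun (x : Fin d → ℝ) (i : Fin d) => ⌊a * x i⌋ := by
  fun_prop

lemma volume_cell {d : ℕ} {a : ℝ} (ha : 0 < a) (z : Fin d → ℤ) :
    volume ((fun (x : Fin d → ℝ) (i : Fin d) => ⌊a * x i⌋) ⁻¹' {z}) =
      ENNReal.ofReal (1 / a) ^ d := by
  have : (fun (x : Fin d → ℝ) (i : Fin d) => ⌊a * x i⌋) ⁻¹' {z} =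
      Set.pi Set.univ fun i => Set.Ico ((z i : ℝ) / a) (((z i : ℝ) + 1) / a) := by
    ext x
    simp only [Set.mem_preimage, Set.mem_singleton_iff, Set.mem_pi, Set.mem_univ, true_imp_iff,
      Set.mem_Ico, funext_iff, Int.floor_eq_iff]
    refine forall_congr' fun i => ?_
    rw [div_le_iff₀ ha, lt_div_iff₀ ha, mul_comm a]
  rw [this, volume_pi_pi]
  simp only [Real.volume_Ico]
  rw [Finset.prod_congr rfl (fun i _ => by
    rw [show ((z i : ℝ) + 1) / a - z i / a = 1 / a by ring])]
  simp

lemma isDensityOn_rescale {d : ℕ} {R a : ℝ} (ha : 0 < a) {μ : (Fin d → ℤ) → ℝ}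
    (h : IsBoxProb d R a μ) : IsDensityOn d R (rescale a μ) := by
  have hnn : ∀ x, 0 ≤ rescale a μ x := fun x => mul_nonneg (by positivity) (h.nonneg _)
  have hmeas : Measurable (rescale a μ) :=
    ((measurable_of_countable μ).comp (measurable_cell a)).const_mul (a ^ d)
  have hl : ∫⁻ x, ENNReal.ofReal (rescale a μ x) = 1 := by
    have h1 : ∫⁻ x, ENNReal.ofReal (rescale a μ x) =
        ∫⁻ z, ENNReal.ofReal (a ^ d * μ z) ∂(Measure.map
          (fun (x : Fin d → ℝ) (i : Fin d) => ⌊a * x i⌋) volume) := by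
      rw [lintegral_map (measurable_of_countable _) (measurable_cell a)]
      rfl
    rw [h1, lintegral_countable']
    simp_rw [Measure.map_apply (measurable_cell a) (measurableSet_singleton _), volume_cell ha]
    have h2 : ∀ z, ENNReal.ofReal (a ^ d * μ z) * ENNReal.ofReal (1 / a) ^ d =
        ENNReal.ofReal (μ z) := by
      intro z
      rw [← ENNReal.ofReal_pow (by positivity),
        ← ENNReal.ofReal_mul (mul_nonneg (by positivity) (h.nonneg z))]
      congr 1
      rw [mul_right_comm, ← mul_pow, mul_one_div_cancel ha.ne', one_pow, one_mul]
    simp_rw [h2]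
    rw [← ENNReal.ofReal_tsum_of_nonneg h.nonneg h.hasSum.summable, h.hasSum.tsum_eq]
    simp
  have hint : Integrable (rescale a μ) := by
    refine ⟨hmeas.aestronglyMeasurable, ?_⟩
    rw [hasFiniteIntegral_iff_ofReal (Eventually.of_forall hnn), hl]
    exact ENNReal.one_lt_top
  refine ⟨hint.integrableOn, hnn, ?_⟩
  rw [setIntegral_eq_integral_of_forall_compl_eq_zero,
    integral_eq_lintegral_of_nonneg_ae (Eventually.of_forall hnn) hmeas.aestronglyMeasurable, hl]
  · simp
  · intro x hx
    by_contra hne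
    exact hx (h.support (subset_tsupport _ hne))

lemma measurable_jumpCount {d : ℕ} (ω : ℕ → (Fin d × Bool) × ℝ) : Measurable (jumpCount ω) := by
  have hset : ∀ n, MeasurableSet {t : ℝ | jumpTime ω n ≤ t} := fun n => measurableSet_Ici
  have hpos : ∀ m : ℕ, m ≠ 0 → MeasurableSet (jumpCount ω ⁻¹' {m}) := by
    intro m hm
    have : jumpCount ω ⁻¹' {m} = {t | jumpTime ω m ≤ t} ∩
        ⋂ k : ℕ, ⋂ _ : m < k, {t | jumpTime ω k ≤ t}ᶜ := by
      ext t
      simp only [Set.mem_preimage, Set.mem_singleton_iff, Set.mem_inter_iff, Set.mem_ofPred_eq,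
        Set.mem_iInter, Set.mem_compl_iff, jumpCount]
      constructor
      · intro h
        have hb : BddAbove {n : ℕ | jumpTime ω n ≤ t} := by
          by_contra hb
          exact hm (h ▸ Nat.sSup_of_not_bddAbove hb)
        have hne : {n : ℕ | jumpTime ω n ≤ t}.Nonempty := by
          by_contra hne
          rw [Set.not_nonempty_iff_eq_empty] at hne
          rw [hne] at h
          exact hm (by simpa using h.symm)
        refine ⟨?_, fun k hk hk' => ?_⟩
        · have := Nat.sSup_mem hne hb
          rw [h] at this
          exact this
        · have := le_csSup hb (show k ∈ {n : ℕ | jumpTime ω n ≤ t} from hk')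
          omega
      · rintro ⟨h1, h2⟩
        refine IsGreatest.csSup_eq ⟨h1, fun k hk => ?_⟩
        by_contra hlt
        exact h2 k (not_le.mp hlt) hk
    rw [this]
    exact (hset m).inter (MeasurableSet.iInter fun k => MeasurableSet.iInter fun _ =>
      (hset k).compl)
  refine measurable_to_countable' fun m => ?_
  by_cases hm : m = 0
  · subst hm
    have : jumpCount ω ⁻¹' {0} = (⋃ k : ℕ, ⋃ _ : k ≠ 0, jumpCount ω ⁻¹' {k})ᶜ := by
      ext t
      simp only [Set.mem_preimage, Set.mem_singleton_iff, Set.mem_compl_iff, Set.mem_iUnion,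
        not_exists]
      exact ⟨fun h k hk hk' => hk (hk'.symm.trans h), fun h => by
        by_contra hne
        exact h _ hne rfl⟩
    rw [this]
    exact (MeasurableSet.iUnion fun k => MeasurableSet.iUnion fun hk => hpos k hk).compl
  · exact hpos m hm

/-- The local times at time `T` add up to `T`. -/
lemma hasSum_localTime {d : ℕ} (ω : ℕ → (Fin d × Bool) × ℝ) {T : ℝ} (hT : 0 ≤ T) :
    (∀ z, 0 ≤ localTime ω T z) ∧ HasSum (localTime ω T) T := by
  classical
  have hw : Measurable (walk ω) :=
    (measurable_of_countable (jumpChain ω)).comp (measurable_jumpCount ω)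
  have hm : ∀ z, MeasurableSet (walk ω ⁻¹' {z}) := fun z => hw (measurableSet_singleton z)
  have heq : ∀ z, localTime ω T z = (volume.restrict (Set.Ioc 0 T)).real (walk ω ⁻¹' {z}) := by
    intro z
    rw [localTime, intervalIntegral.integral_of_le hT, ← integral_indicator_one (hm z)]
    refine integral_congr_ae (Eventually.of_forall fun s => ?_)
    simp [Set.indicator_apply]
  have htot : ∑' z, (volume.restrict (Set.Ioc 0 T)) (walk ω ⁻¹' {z}) = ENNReal.ofReal T := by
    rw [← measure_iUnion (fun x y hxy => Set.disjoint_left.mpr fun s hs hs' =>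
      hxy (hs.symm.trans hs')) hm]
    have : (⋃ z, walk ω ⁻¹' {z}) = Set.univ := by
      ext s
      simp
    rw [this]
    simp
  refine ⟨fun z => by rw [heq]; exact measureReal_nonneg, ?_⟩
  have hfun : localTime ω T = fun z =>
      ((volume.restrict (Set.Ioc 0 T)) (walk ω ⁻¹' {z})).toReal := funext heq
  rw [hfun]
  have := ENNReal.hasSum_toReal (f := fun z =>
    (volume.restrict (Set.Ioc 0 T)) (walk ω ⁻¹' {z})) (by rw [htot]; exact ENNReal.ofReal_ne_top)
  rw [← ENNReal.tsum_toReal_eq (fun z => measure_ne_top _ _), htot, ENNReal.toReal_ofReal hT]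
    at this
  exact this

lemma isDensityOn_rescaledLocalTime {d : ℕ} {R a T : ℝ} (ha : 0 < a) (hT : 0 < T)
    (ω : ℕ → (Fin d × Bool) × ℝ) (h : tsupport (rescaledLocalTime a T ω) ⊆ cube d R) :
    IsDensityOn d R (rescaledLocalTime a T ω) := by
  obtain ⟨h0, h1⟩ := hasSum_localTime ω hT.le
  refine isDensityOn_rescale ha ⟨fun z => div_nonneg (h0 z) hT.le, ?_, h⟩
  have := h1.div_const T
  rwa [div_self hT.ne'] at this

end RescaledLocalTimes

end

noncomputable section

namespace RescaledLocalTimes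

open ProbabilityTheory

/-! This is the Donsker–Varadhan upper bound with an explicit error. Let B be the lattice box and u
≥ 0 a function positive on B and zero outside. With V = -Au/u, the Feynman–Kac functional exp(∫
V(X_s) ds) u(X_T), killed on leaving B, has expectation at most u(0)
(`lintegral_tsum_stoppedValue_le`). On the support event the exponent is ∑ V ℓ_T
(`exp_sum_potential_le_tsum_stoppedValue`).

For μ = ℓ_T / T the choice u = √μ would turn ∑ V μ into the discrete Dirichlet energy, and the
discrete variational bound c gives (T/a²) F ≤ T·energy - cT/a². But this u is random and may vanish,
so √μ is rounded up to a grid of mesh 1/n with n ≥ T (`exists_grid_dirichletForm_le`), and the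
moment is bounded by a sum over all (n+1)^|B| grid functions (`expMoment_le`).

With n = ⌈T⌉ and |B| of order α^d, the total cost in the exponent is O(α^d log T). After
multiplication by α²/T this is O(α^(d+2) log T / T), which vanishes precisely by the growth
condition on α. -/

/-! ### Exponential holding times -/

lemma measurable_exponentialPDF (r : ℝ) : Measurable (exponentialPDF r) :=
  (measurable_exponentialPDFReal r).ennreal_ofReal

lemma lintegral_expMeasure (r : ℝ) (f : ℝ → ℝ≥0∞) :
    ∫⁻ x, f x ∂(expMeasure r) = ∫⁻ x in Set.Ici 0, ENNReal.ofReal (r * Real.exp (-(r * x))) * f x := by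
  have h1 : expMeasure r = volume.withDensity (exponentialPDF r) := rfl
  rw [h1, lintegral_withDensity_eq_lintegral_mul_non_measurable _
    (measurable_exponentialPDF r) (by simp [exponentialPDF]),
    ← lintegral_indicator measurableSet_Ici]
  refine lintegral_congr fun x => ?_
  by_cases hx : 0 ≤ x
  · simp [hx, exponentialPDF_eq]
  · simp [hx, exponentialPDF_eq]

lemma lintegral_ofReal_mul_exp_neg_Ico {c t : ℝ} (hc : 0 ≤ c) (ht : 0 ≤ t) :
    ∫⁻ x in Set.Ico 0 t, ENNReal.ofReal (c * Real.exp (-(c * x))) =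
      ENNReal.ofReal (1 - Real.exp (-(c * t))) := by
  rw [restrict_Ico_eq_restrict_Ioc, ← ofReal_integral_eq_lintegral_ofReal,
    ← intervalIntegral.integral_of_le ht]
  · congr 1
    rw [intervalIntegral.integral_eq_sub_of_hasDerivAt (f := fun x => - Real.exp (-(c * x)))]
    · simp only [mul_zero, neg_zero, Real.exp_zero]
      ring
    · intro x _
      have h := ((((hasDerivAt_id' x).const_mul c).fun_neg).exp).fun_neg
      convert h using 1
      ring
    · exact (Continuous.intervalIntegrable (by fun_prop) _ _)
  · exact (Continuous.integrableOn_Ioc (by fun_prop))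
  · exact Eventually.of_forall fun x => by positivity

lemma lintegral_ofReal_mul_exp_neg_Ici {r : ℝ} (hr : 0 < r) (t : ℝ) :
    ∫⁻ x in Set.Ici t, ENNReal.ofReal (r * Real.exp (-(r * x))) =
      ENNReal.ofReal (Real.exp (-(r * t))) := by
  rw [← setLIntegral_congr Ioi_ae_eq_Ici, ← ofReal_integral_eq_lintegral_ofReal]
  · congr 1
    have := integral_exp_mul_Ioi (a := -r) (by linarith) t
    rw [integral_const_mul]
    simp only [neg_mul] at this
    rw [this]
    field_simp
  · have := (integrableOn_exp_mul_Ioi (a := -r) (by linarith) t).const_mul r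
    simpa only [neg_mul] using this
  · exact Eventually.of_forall fun x => by positivity

/-- The one-step Feynman–Kac identity for an exponential holding time of rate `r`. -/
lemma lintegral_expMeasure_stop_or_jump {r c t : ℝ} (hr : 0 < r) (hc : 0 ≤ c) (ht : 0 ≤ t) :
    ∫⁻ τ, (if t ≤ τ then ENNReal.ofReal (Real.exp ((r - c) * t))
      else ENNReal.ofReal (Real.exp ((r - c) * τ) * (c / r))) ∂(expMeasure r) = 1 := by
  rw [lintegral_expMeasure, ← Set.Ico_union_Ici_eq_Ici ht,
    lintegral_union measurableSet_Ici
      (Set.disjoint_left.mpr fun x hx hx' => (not_le.mpr hx.2) hx')]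
  -- A jump before t contributes the density c e^(-cx), of mass 1 - e^(-ct); a stay beyond t
  -- contributes e^(-rt) e^((r-c)t) = e^(-ct).
  have h1 : ∫⁻ x in Set.Ico 0 t, ENNReal.ofReal (r * Real.exp (-(r * x))) *
      (if t ≤ x then ENNReal.ofReal (Real.exp ((r - c) * t))
        else ENNReal.ofReal (Real.exp ((r - c) * x) * (c / r))) =
      ∫⁻ x in Set.Ico 0 t, ENNReal.ofReal (c * Real.exp (-(c * x))) := by
    refine setLIntegral_congr_fun measurableSet_Ico fun x hx => ?_
    simp only [not_le.mpr hx.2, if_false]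
    rw [← ENNReal.ofReal_mul (by positivity)]
    congr 1
    rw [show -(c * x) = -(r * x) + (r - c) * x by ring, Real.exp_add]
    field_simp
  have h2 : ∫⁻ x in Set.Ici t, ENNReal.ofReal (r * Real.exp (-(r * x))) *
      (if t ≤ x then ENNReal.ofReal (Real.exp ((r - c) * t))
        else ENNReal.ofReal (Real.exp ((r - c) * x) * (c / r))) =
      (∫⁻ x in Set.Ici t, ENNReal.ofReal (r * Real.exp (-(r * x)))) *
        ENNReal.ofReal (Real.exp ((r - c) * t)) := by
    rw [← lintegral_mul_const _ (by fun_prop)]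
    refine setLIntegral_congr_fun measurableSet_Ici fun x hx => ?_
    simp only [show t ≤ x from hx, if_true]
  rw [h1, h2, lintegral_ofReal_mul_exp_neg_Ico hc ht, lintegral_ofReal_mul_exp_neg_Ici hr,
    ← ENNReal.ofReal_mul (by positivity), ← Real.exp_add,
    show -(r * t) + (r - c) * t = -(c * t) by ring, ← ENNReal.ofReal_add _ (by positivity)]
  · simp
  · have : Real.exp (-(c * t)) ≤ 1 := Real.exp_le_one_iff.mpr (by nlinarith [mul_nonneg hc ht])
    linarith

/-- The Laplace transform of an exponential holding time is less than one. -/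
lemma lintegral_expMeasure_exp_neg_lt_one {r : ℝ} (hr : 0 < r) :
    ∫⁻ τ, ENNReal.ofReal (Real.exp (-τ)) ∂(expMeasure r) < 1 := by
  rw [lintegral_expMeasure]
  -- Tilting by e^(-x) gives the density of rate r + 1, times r/(r+1) < 1.
  have : ∀ x : ℝ, ENNReal.ofReal (r * Real.exp (-(r * x))) * ENNReal.ofReal (Real.exp (-x)) =
      ENNReal.ofReal ((r + 1) * Real.exp (-((r + 1) * x))) * ENNReal.ofReal (r / (r + 1)) := by
    intro x
    rw [← ENNReal.ofReal_mul (by positivity), ← ENNReal.ofReal_mul (by positivity)]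
    congr 1
    rw [show -((r + 1) * x) = -(r * x) + -x by ring, Real.exp_add]
    field_simp
  simp_rw [this]
  rw [lintegral_mul_const _ (by fun_prop), lintegral_ofReal_mul_exp_neg_Ici (by positivity)]
  simp only [mul_zero, neg_zero, Real.exp_zero, ENNReal.ofReal_one, one_mul]
  rw [ENNReal.ofReal_lt_one, div_lt_one (by positivity)]
  linarith

lemma ae_expMeasure_pos (r : ℝ) : ∀ᵐ τ ∂(expMeasure r), 0 < τ := by
  have h1 : expMeasure r = volume.withDensity (exponentialPDF r) := rfl
  rw [h1, ae_withDensity_iff (measurable_exponentialPDF r)]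
  have : ∀ᵐ τ : ℝ, τ ≠ 0 := by simp [ae_iff]
  filter_upwards [this] with τ h0 hτ
  by_contra hlt
  exact hτ (exponentialPDF_of_neg (lt_of_le_of_ne (not_lt.mp hlt) h0))

/-! ### Law of one step and independence of the past -/

/-- The joint law of a jump direction and a holding time. -/
abbrev stepLaw (d : ℕ) [NeZero d] (κ : ℝ) : Measure ((Fin d × Bool) × ℝ) :=
  (PMF.uniformOfFintype (Fin d × Bool)).toMeasure.prod (expMeasure (2 * d * κ))

lemma lintegral_stepLaw (d : ℕ) [NeZero d] {κ : ℝ} (hκ : 0 < κ) {f : (Fin d × Bool) × ℝ → ℝ≥0∞}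
    (hf : Measurable f) :
    ∫⁻ p, f p ∂(stepLaw d κ) =
      ∫⁻ τ, ∑ s, f (s, τ) * ENNReal.ofReal (1 / (2 * d)) ∂(expMeasure (2 * d * κ)) := by
  have hd : (0 : ℝ) < d := by exact_mod_cast Nat.pos_of_ne_zero (NeZero.ne d)
  have := isProbabilityMeasure_expMeasure (r := 2 * d * κ) (by positivity)
  rw [lintegral_prod_symm _ hf.aemeasurable]
  refine lintegral_congr fun τ => ?_
  rw [lintegral_fintype]
  refine Finset.sum_congr rfl fun s _ => ?_
  rw [PMF.toMeasure_apply_singleton _ _ (measurableSet_singleton _), PMF.uniformOfFintype_apply]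
  congr 1
  rw [one_div, ENNReal.ofReal_inv_of_pos (by positivity)]
  congr 1
  simp only [Fintype.card_prod, Fintype.card_fin, Fintype.card_bool]
  rw [← ENNReal.ofReal_natCast]
  congr 1
  push_cast
  ring

/-- Resampling one coordinate of an i.i.d. sequence does not change its law. -/
lemma map_update_infinitePi {E : Type*} [MeasurableSpace E] (μ : Measure E)
    [IsProbabilityMeasure μ] (n : ℕ) :
    ((Measure.infinitePi fun _ : ℕ => μ).prod μ).map
      (fun p : (ℕ → E) × E => Function.update p.1 n p.2) = Measure.infinitePi fun _ : ℕ => μ := by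
  have hm : Measurable fun p : (ℕ → E) × E => Function.update p.1 n p.2 := by
    refine measurable_pi_iff.mpr fun k => ?_
    by_cases hk : k = n
    · subst hk
      simpa using measurable_snd
    · simp only [Function.update_of_ne hk]
      fun_prop
  refine Measure.eq_infinitePi _ fun s t ht => ?_
  rw [Measure.map_apply hm (MeasurableSet.pi s.countable_toSet fun i _ => ht i)]
  have hpre : (fun p : (ℕ → E) × E => Function.update p.1 n p.2) ⁻¹' (Set.pi s t) =
      (Set.pi (s.erase n) t) ×ˢ (if n ∈ s then t n else Set.univ) := by
    ext p
    simp only [Set.mem_preimage, Set.mem_pi, Set.mem_prod, Finset.mem_coe, Finset.mem_erase]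
    constructor
    · intro h
      refine ⟨fun i hi => by simpa [Function.update_of_ne hi.1] using h i hi.2, ?_⟩
      split_ifs with hn
      · simpa using h n hn
      · trivial
    · rintro ⟨h1, h2⟩ i hi
      by_cases hin : i = n
      · subst hin
        simpa [hi] using h2
      · simpa [Function.update_of_ne hin] using h1 i ⟨hin, hi⟩
  rw [hpre, Measure.prod_prod, Measure.infinitePi_pi _ (fun i _ => ht i)]
  split_ifs with hn
  · rw [Finset.prod_erase_mul _ _ hn]
  · rw [measure_univ, mul_one, Finset.erase_eq_of_notMem hn]

/-- Fubini for a functional of the first `n` coordinates and the next one. -/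
lemma lintegral_infinitePi_history {E S : Type*} [MeasurableSpace E] [MeasurableSpace S]
    (μ : Measure E) [IsProbabilityMeasure μ] (n : ℕ) {H : (ℕ → E) → S} (hH : Measurable H)
    (hHn : ∀ ω ω', (∀ k < n, ω k = ω' k) → H ω = H ω') {f : S × E → ℝ≥0∞} (hf : Measurable f) :
    ∫⁻ ω, f (H ω, ω n) ∂(Measure.infinitePi fun _ : ℕ => μ) =
      ∫⁻ ω, ∫⁻ e, f (H ω, e) ∂μ ∂(Measure.infinitePi fun _ : ℕ => μ) := by
  have hm : Measurable fun p : (ℕ → E) × E => Function.update p.1 n p.2 := by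
    refine measurable_pi_iff.mpr fun k => ?_
    by_cases hk : k = n
    · subst hk
      simpa using measurable_snd
    · simp only [Function.update_of_ne hk]
      fun_prop
  conv_lhs => rw [← map_update_infinitePi μ n]
  rw [lintegral_map (by fun_prop) hm, lintegral_prod _ (by fun_prop)]
  refine lintegral_congr fun ω => lintegral_congr fun e => ?_
  rw [Function.update_self, hHn _ ω fun k hk => Function.update_of_ne hk.ne _ _]

/-! ### Feynman–Kac functional along the jump chain -/

variable {d : ℕ}

/-- The potential `-A u / u` on the set where `u` does not vanish, for the walk killed where
`u` vanishes. -/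
def potential (κ : ℝ) (u : (Fin d → ℤ) → ℝ) (x : Fin d → ℤ) : ℝ :=
  2 * d * κ - κ * ((∑ s, u (x + unitStep s)) / u x)

/-- The Feynman–Kac factor of a stay of length `τ` at `x`. -/
def stayFactor (κ : ℝ) (u : (Fin d → ℤ) → ℝ) (x : Fin d → ℤ) (τ : ℝ) : ℝ≥0∞ :=
  if u x = 0 then 0 else ENNReal.ofReal (Real.exp (potential κ u x * τ))

/-- The Feynman–Kac weight accumulated before the `n`-th jump. -/
def pathWeight (κ : ℝ) (u : (Fin d → ℤ) → ℝ) (ω : ℕ → (Fin d × Bool) × ℝ) (n : ℕ) : ℝ≥0∞ :=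
  ∏ k ∈ Finset.range n, stayFactor κ u (jumpChain ω k) (ω k).2

/-- The Feynman–Kac functional on the event of more than `n` jumps before time `T`. -/
def runningValue (κ : ℝ) (u : (Fin d → ℤ) → ℝ) (T : ℝ) (n : ℕ)
    (ω : ℕ → (Fin d × Bool) × ℝ) : ℝ≥0∞ :=
  if jumpTime ω n < T then pathWeight κ u ω n * ENNReal.ofReal (u (jumpChain ω n)) else 0

/-- The Feynman–Kac functional on the event of exactly `n` jumps before time `T`. -/
def stoppedValue (κ : ℝ) (u : (Fin d → ℤ) → ℝ) (T : ℝ) (n : ℕ)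
    (ω : ℕ → (Fin d × Bool) × ℝ) : ℝ≥0∞ :=
  if jumpTime ω n < T ∧ T ≤ jumpTime ω (n + 1) then
    pathWeight κ u ω n * (stayFactor κ u (jumpChain ω n) (T - jumpTime ω n) *
      ENNReal.ofReal (u (jumpChain ω n))) else 0

lemma jumpTime_succ (ω : ℕ → (Fin d × Bool) × ℝ) (n : ℕ) :
    jumpTime ω (n + 1) = jumpTime ω n + (ω n).2 := Finset.sum_range_succ _ _

lemma jumpChain_succ (ω : ℕ → (Fin d × Bool) × ℝ) (n : ℕ) :
    jumpChain ω (n + 1) = jumpChain ω n + unitStep (ω n).1 := Finset.sum_range_succ _ _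

lemma measurable_jumpTime (n : ℕ) :
    Measurable fun ω : ℕ → (Fin d × Bool) × ℝ => jumpTime ω n := by
  unfold jumpTime
  fun_prop

lemma measurable_jumpChain (n : ℕ) :
    Measurable fun ω : ℕ → (Fin d × Bool) × ℝ => jumpChain ω n := by
  have : Measurable (unitStep : Fin d × Bool → Fin d → ℤ) := measurable_of_countable _
  unfold jumpChain
  fun_prop

lemma measurable_stayFactor (κ : ℝ) (u : (Fin d → ℤ) → ℝ) :
    Measurable fun p : (Fin d → ℤ) × ℝ => stayFactor κ u p.1 p.2 := by
  have hu : Measurable u := measurable_of_countable _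
  have hV : Measurable (potential κ u) := measurable_of_countable _
  refine Measurable.ite ((hu.comp measurable_fst) (measurableSet_singleton 0))
    measurable_const ?_
  fun_prop

lemma measurable_pathWeight (κ : ℝ) (u : (Fin d → ℤ) → ℝ) (n : ℕ) :
    Measurable fun ω => pathWeight κ u ω n := by
  refine Finset.measurable_prod _ fun k _ => ?_
  exact (measurable_stayFactor κ u).comp
    ((measurable_jumpChain k).prodMk (measurable_snd.comp (measurable_pi_apply k)))

lemma measurable_stoppedValue (κ : ℝ) (u : (Fin d → ℤ) → ℝ) (T : ℝ) (n : ℕ) :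
    Measurable (stoppedValue κ u T n) := by
  have hu : Measurable u := measurable_of_countable _
  refine Measurable.ite ((measurableSet_lt (measurable_jumpTime n) measurable_const).inter
    (measurableSet_le measurable_const (measurable_jumpTime (n + 1)))) ?_ measurable_const
  exact (measurable_pathWeight κ u n).mul (((measurable_stayFactor κ u).comp
    ((measurable_jumpChain n).prodMk (measurable_const.sub (measurable_jumpTime n)))).mul
    (hu.comp (measurable_jumpChain n)).ennreal_ofReal)

/-- The Feynman–Kac functional of one jump, started at `x` with remaining time `t`. -/
def oneJumpValue (κ : ℝ) (u : (Fin d → ℤ) → ℝ) (x : Fin d → ℤ) (t : ℝ)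
    (p : (Fin d × Bool) × ℝ) : ℝ≥0∞ :=
  if t ≤ p.2 then stayFactor κ u x t * ENNReal.ofReal (u x)
  else stayFactor κ u x p.2 * ENNReal.ofReal (u (x + unitStep p.1))

lemma measurable_oneJumpValue (κ : ℝ) (u : (Fin d → ℤ) → ℝ) :
    Measurable fun q : ((Fin d → ℤ) × ℝ) × (Fin d × Bool) × ℝ =>
      oneJumpValue κ u q.1.1 q.1.2 q.2 := by
  have hu : Measurable u := measurable_of_countable _
  have hs : Measurable (unitStep : Fin d × Bool → Fin d → ℤ) := measurable_of_countable _
  have hf := measurable_stayFactor κ u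
  refine Measurable.ite (measurableSet_le (by fun_prop) (by fun_prop)) ?_ ?_
  · exact (hf.comp measurable_fst).mul (by fun_prop)
  · exact (hf.comp ((measurable_fst.comp measurable_fst).prodMk
      (measurable_snd.comp measurable_snd))).mul (by fun_prop)

lemma measurable_oneJumpValue_right (κ : ℝ) (u : (Fin d → ℤ) → ℝ) (x : Fin d → ℤ) (t : ℝ) :
    Measurable (oneJumpValue κ u x t) :=
  (measurable_oneJumpValue κ u).comp (measurable_const (a := (x, t)).prodMk measurable_id)

/-- Where u vanishes the walk is killed and there is nothing to integrate. Elsewhere put r = 2dκ and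
c = κ ∑ u(y)/u(x): the potential is r - c and averaging u over the neighbours gives (c/r) u(x), so
the bound is `lintegral_expMeasure_stop_or_jump` times u(x). -/
lemma lintegral_oneJumpValue_le [NeZero d] {κ : ℝ} (hκ : 0 < κ) {u : (Fin d → ℤ) → ℝ}
    (hu : ∀ x, 0 ≤ u x) (x : Fin d → ℤ) {t : ℝ} (ht : 0 ≤ t) :
    ∫⁻ p, oneJumpValue κ u x t p ∂(stepLaw d κ) ≤ ENNReal.ofReal (u x) := by
  have hd : (0 : ℝ) < d := by exact_mod_cast Nat.pos_of_ne_zero (NeZero.ne d)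
  rcases (hu x).eq_or_lt with h0 | hpos
  · have : ∀ p, oneJumpValue κ u x t p = 0 := by
      intro p
      simp [oneJumpValue, stayFactor, ← h0]
    simp [this]
  rw [lintegral_stepLaw d hκ (measurable_oneJumpValue_right κ u x t)]
  set c : ℝ := κ * ((∑ s, u (x + unitStep s)) / u x) with hc
  have hc0 : 0 ≤ c := mul_nonneg hκ.le (div_nonneg (Finset.sum_nonneg fun s _ => hu _) hpos.le)
  have hV : potential κ u x = 2 * d * κ - c := rfl
  have hstay : ∀ τ, stayFactor κ u x τ = ENNReal.ofReal (Real.exp ((2 * d * κ - c) * τ)) := by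
    intro τ
    rw [stayFactor, if_neg hpos.ne', hV]
  have hsum : ∀ τ, ∑ s, oneJumpValue κ u x t (s, τ) * ENNReal.ofReal (1 / (2 * d)) =
      (if t ≤ τ then ENNReal.ofReal (Real.exp ((2 * d * κ - c) * t))
      else ENNReal.ofReal (Real.exp ((2 * d * κ - c) * τ) * (c / (2 * d * κ)))) *
        ENNReal.ofReal (u x) := by
    intro τ
    simp only [oneJumpValue, hstay]
    split_ifs with h
    · rw [Finset.sum_const, Finset.card_univ, Fintype.card_prod, Fintype.card_fin,
        Fintype.card_bool, nsmul_eq_mul, mul_comm (_ * _) (ENNReal.ofReal (1 / _)), ← mul_assoc]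
      have : ((d * 2 : ℕ) : ℝ≥0∞) * ENNReal.ofReal (1 / (2 * d)) = 1 := by
        rw [← ENNReal.ofReal_natCast, ← ENNReal.ofReal_mul (by positivity)]
        push_cast
        rw [show (d : ℝ) * 2 * (1 / (2 * d)) = 1 by field_simp, ENNReal.ofReal_one]
      rw [this, one_mul]
    · rw [← Finset.sum_mul, ← Finset.mul_sum, ← ENNReal.ofReal_sum_of_nonneg fun s _ => hu _,
        ← ENNReal.ofReal_mul (by positivity), ← ENNReal.ofReal_mul
          (mul_nonneg (by positivity) (Finset.sum_nonneg fun s _ => hu _)),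
        ← ENNReal.ofReal_mul (by positivity)]
      congr 1
      rw [hc]
      field_simp
  simp_rw [hsum]
  rw [lintegral_mul_const, lintegral_expMeasure_stop_or_jump (by positivity) hc0 ht, one_mul]
  refine Measurable.ite measurableSet_Ici measurable_const (by fun_prop)

lemma ae_walkLaw_pos (d : ℕ) [NeZero d] {κ : ℝ} (hκ : 0 < κ) :
    ∀ᵐ ω ∂(walkLaw d κ), ∀ n, 0 < (ω n).2 := by
  have hd : (0 : ℝ) < d := by exact_mod_cast Nat.pos_of_ne_zero (NeZero.ne d)
  have := isProbabilityMeasure_expMeasure (r := 2 * d * κ) (by positivity)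
  rw [ae_all_iff]
  intro n
  have h1 : ∀ᵐ p ∂(stepLaw d κ), 0 < p.2 :=
    Measure.quasiMeasurePreserving_snd.ae (ae_expMeasure_pos (2 * d * κ))
  exact (measurePreserving_eval_infinitePi (fun _ : ℕ => stepLaw d κ) n).quasiMeasurePreserving.ae h1

/-- The supermartingale step: given the first n coordinates, coordinate n either carries the walk
past T or produces one more jump, and the one-jump bound applies with remaining time T minus the
n-th jump time. -/
lemma lintegral_stoppedValue_add_runningValue_le [NeZero d] {κ : ℝ} (hκ : 0 < κ)
    {u : (Fin d → ℤ) → ℝ} (hu : ∀ x, 0 ≤ u x) (T : ℝ) (n : ℕ) :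
    ∫⁻ ω, stoppedValue κ u T n ω ∂(walkLaw d κ) + ∫⁻ ω, runningValue κ u T (n + 1) ω ∂(walkLaw d κ)
      ≤ ∫⁻ ω, runningValue κ u T n ω ∂(walkLaw d κ) := by
  have hd : (0 : ℝ) < d := by exact_mod_cast Nat.pos_of_ne_zero (NeZero.ne d)
  have := isProbabilityMeasure_expMeasure (r := 2 * d * κ) (by positivity)
  rw [← lintegral_add_left (measurable_stoppedValue κ u T n)]
  let H : (ℕ → (Fin d × Bool) × ℝ) → ((Fin d → ℤ) × ℝ) × ℝ≥0∞ := fun ω =>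
    ((jumpChain ω n, jumpTime ω n), pathWeight κ u ω n)
  have hH : Measurable H :=
    ((measurable_jumpChain n).prodMk (measurable_jumpTime n)).prodMk (measurable_pathWeight κ u n)
  have hHn : ∀ ω ω', (∀ k < n, ω k = ω' k) → H ω = H ω' := by
    intro ω ω' h
    have hchain : ∀ m ≤ n, jumpChain ω m = jumpChain ω' m := fun m hm =>
      Finset.sum_congr rfl fun k hk => by rw [h k ((Finset.mem_range.mp hk).trans_le hm)]
    have htime : jumpTime ω n = jumpTime ω' n :=
      Finset.sum_congr rfl fun k hk => by rw [h k (Finset.mem_range.mp hk)]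
    have hweight : pathWeight κ u ω n = pathWeight κ u ω' n :=
      Finset.prod_congr rfl fun k hk => by
        rw [h k (Finset.mem_range.mp hk), hchain k (Finset.mem_range.mp hk).le]
    simp only [H, hchain n le_rfl, htime, hweight]
  let f : (((Fin d → ℤ) × ℝ) × ℝ≥0∞) × (Fin d × Bool) × ℝ → ℝ≥0∞ := fun q =>
    if q.1.1.2 < T then q.1.2 * oneJumpValue κ u q.1.1.1 (T - q.1.1.2) q.2 else 0
  have hf : Measurable f := by
    refine Measurable.ite (measurableSet_lt (by fun_prop) (by fun_prop)) ?_ measurable_const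
    refine Measurable.mul (by fun_prop) ?_
    exact (measurable_oneJumpValue κ u).comp
      (f := fun q : (((Fin d → ℤ) × ℝ) × ℝ≥0∞) × (Fin d × Bool) × ℝ =>
        ((q.1.1.1, T - q.1.1.2), q.2)) (by fun_prop)
  calc ∫⁻ ω, (stoppedValue κ u T n ω + runningValue κ u T (n + 1) ω) ∂(walkLaw d κ)
      ≤ ∫⁻ ω, f (H ω, ω n) ∂(walkLaw d κ) := by
        refine lintegral_mono_ae ?_
        filter_upwards [ae_walkLaw_pos d hκ] with ω hω
        have hpos := hω n
        have hpw : pathWeight κ u ω (n + 1) =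
            pathWeight κ u ω n * stayFactor κ u (jumpChain ω n) (ω n).2 :=
          Finset.prod_range_succ _ _
        simp only [f, H, stoppedValue, runningValue, oneJumpValue, jumpTime_succ, jumpChain_succ,
          hpw, tsub_le_iff_left]
        by_cases h1 : jumpTime ω n < T
        · by_cases h2 : T ≤ jumpTime ω n + (ω n).2
          · simp [h1, h2, not_lt.mpr h2]
          · simp [h1, h2, not_le.mp h2, mul_assoc]
        -- Positivity of the holding time enters here: once T is passed, later jumps come after T as
        -- well.
        · have : ¬ jumpTime ω n + (ω n).2 < T := by linarith
          simp [h1, this]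
    _ = ∫⁻ ω, ∫⁻ p, f (H ω, p) ∂(stepLaw d κ) ∂(walkLaw d κ) :=
        lintegral_infinitePi_history _ n hH hHn hf
    _ ≤ ∫⁻ ω, runningValue κ u T n ω ∂(walkLaw d κ) := by
        refine lintegral_mono fun ω => ?_
        simp only [f, H, runningValue]
        split_ifs with h1
        · rw [lintegral_const_mul _ (measurable_oneJumpValue_right κ u _ _)]
          gcongr
          exact lintegral_oneJumpValue_le hκ hu _ (by linarith)
        · simp

/-- The Feynman–Kac upper bound: `u` is excessive for the walk killed where `u` vanishes, with
potential `-A u / u`. -/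
lemma lintegral_tsum_stoppedValue_le [NeZero d] {κ : ℝ} (hκ : 0 < κ)
    {u : (Fin d → ℤ) → ℝ} (hu : ∀ x, 0 ≤ u x) (T : ℝ) :
    ∫⁻ ω, ∑' n, stoppedValue κ u T n ω ∂(walkLaw d κ) ≤ ENNReal.ofReal (u 0) := by
  have := isProbabilityMeasure_walkLaw d hκ
  rw [lintegral_tsum fun n => (measurable_stoppedValue κ u T n).aemeasurable]
  refine ENNReal.tsum_le_of_sum_range_le fun N => ?_
  -- Keeping the running term on the left makes the one-step inequalities telescope; it is discarded
  -- only at the end.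
  have h : ∑ n ∈ Finset.range N, ∫⁻ ω, stoppedValue κ u T n ω ∂(walkLaw d κ) +
      ∫⁻ ω, runningValue κ u T N ω ∂(walkLaw d κ) ≤
      ∫⁻ ω, runningValue κ u T 0 ω ∂(walkLaw d κ) := by
    induction N with
    | zero => simp
    | succ N ih =>
      rw [Finset.sum_range_succ, add_assoc]
      exact (add_le_add le_rfl (lintegral_stoppedValue_add_runningValue_le hκ hu T N)).trans ih
  refine (le_self_add.trans h).trans ?_
  calc ∫⁻ ω, runningValue κ u T 0 ω ∂(walkLaw d κ)
      ≤ ∫⁻ _, ENNReal.ofReal (u 0) ∂(walkLaw d κ) := by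
        refine lintegral_mono fun ω => ?_
        simp only [runningValue, pathWeight, jumpChain, Finset.range_zero, Finset.prod_empty,
          Finset.sum_empty, one_mul]
        split_ifs <;> simp
    _ = ENNReal.ofReal (u 0) := by simp

/-! ### Non-explosion -/

lemma measurable_ofReal_exp_neg_jumpTime (n : ℕ) :
    Measurable fun ω : ℕ → (Fin d × Bool) × ℝ => ENNReal.ofReal (Real.exp (-jumpTime ω n)) :=
  (measurable_jumpTime n).neg.exp.ennreal_ofReal

lemma lintegral_exp_neg_jumpTime [NeZero d] {κ : ℝ} (hκ : 0 < κ) (n : ℕ) :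
    ∫⁻ ω, ENNReal.ofReal (Real.exp (-jumpTime ω n)) ∂(walkLaw d κ) =
      (∫⁻ τ, ENNReal.ofReal (Real.exp (-τ)) ∂(expMeasure (2 * d * κ))) ^ n := by
  have hd : (0 : ℝ) < d := by exact_mod_cast Nat.pos_of_ne_zero (NeZero.ne d)
  have := isProbabilityMeasure_expMeasure (r := 2 * d * κ) (by positivity)
  have := isProbabilityMeasure_walkLaw d hκ
  induction n with
  | zero => simp [jumpTime]
  | succ n ih =>
    rw [pow_succ, ← ih]
    have h1 : ∀ ω : ℕ → (Fin d × Bool) × ℝ, ENNReal.ofReal (Real.exp (-jumpTime ω (n + 1))) =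
        ENNReal.ofReal (Real.exp (-jumpTime ω n)) * ENNReal.ofReal (Real.exp (-(ω n).2)) := by
      intro ω
      rw [jumpTime_succ, ← ENNReal.ofReal_mul (by positivity), ← Real.exp_add]
      ring_nf
    simp_rw [h1]
    have h2 := lintegral_infinitePi_history (stepLaw d κ) n (measurable_jumpTime n)
      (fun ω ω' h => Finset.sum_congr rfl fun k hk => by rw [h k (Finset.mem_range.mp hk)])
      (f := fun q : ℝ × (Fin d × Bool) × ℝ =>
        ENNReal.ofReal (Real.exp (-q.1)) * ENNReal.ofReal (Real.exp (-q.2.2))) (by fun_prop)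
    refine h2.trans ?_
    have h3 : ∫⁻ p : (Fin d × Bool) × ℝ, ENNReal.ofReal (Real.exp (-p.2)) ∂(stepLaw d κ) =
        ∫⁻ τ, ENNReal.ofReal (Real.exp (-τ)) ∂(expMeasure (2 * d * κ)) :=
      measurePreserving_snd.lintegral_comp
        (f := fun τ => ENNReal.ofReal (Real.exp (-τ))) (by fun_prop)
    rw [← h3, ← lintegral_mul_const _ (measurable_ofReal_exp_neg_jumpTime n)]
    refine lintegral_congr fun ω => ?_
    dsimp only
    rw [lintegral_const_mul]
    fun_prop

/-- The walk almost surely does not explode. -/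
lemma ae_walkLaw_exists_lt_jumpTime (d : ℕ) [NeZero d] {κ : ℝ} (hκ : 0 < κ) (T : ℝ) :
    ∀ᵐ ω ∂(walkLaw d κ), ∃ n, T < jumpTime ω n := by
  have hd : (0 : ℝ) < d := by exact_mod_cast Nat.pos_of_ne_zero (NeZero.ne d)
  have hq := lintegral_expMeasure_exp_neg_lt_one (r := 2 * d * κ) (by positivity)
  rw [ae_iff]
  set S := {ω : ℕ → (Fin d × Bool) × ℝ | ¬ ∃ n, T < jumpTime ω n}
  -- Markov's inequality: on `S` every exp(-jump time) is at least e^(-T), while its mean decays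
  -- geometrically in n.
  have hle : ∀ n, ENNReal.ofReal (Real.exp (-T)) * walkLaw d κ S ≤
      (∫⁻ τ, ENNReal.ofReal (Real.exp (-τ)) ∂(expMeasure (2 * d * κ))) ^ n := by
    intro n
    rw [← lintegral_exp_neg_jumpTime hκ]
    refine le_trans ?_ (mul_meas_ge_le_lintegral (measurable_ofReal_exp_neg_jumpTime n)
      (ENNReal.ofReal (Real.exp (-T))))
    gcongr
    intro ω hω
    have hω' : jumpTime ω n ≤ T := by
      by_contra h
      exact hω ⟨n, not_le.mp h⟩
    exact ENNReal.ofReal_le_ofReal (Real.exp_le_exp.mpr (by simpa using hω'))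
  have h0 : ENNReal.ofReal (Real.exp (-T)) * walkLaw d κ S ≤ 0 :=
    ge_of_tendsto' (ENNReal.tendsto_pow_atTop_nhds_zero_of_lt_one hq) hle
  rcases mul_eq_zero.mp (nonpos_iff_eq_zero.mp h0) with h | h
  · exact absurd h (by simp [Real.exp_pos])
  · exact h

/-! ### Local times through the jump chain -/

variable {ω : ℕ → (Fin d × Bool) × ℝ}

lemma strictMono_jumpTime (hω : ∀ n, 0 < (ω n).2) : StrictMono (jumpTime ω) :=
  strictMono_nat_of_lt_succ fun n => by
    rw [jumpTime_succ]
    linarith [hω n]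

lemma walk_eq_jumpChain (hω : ∀ n, 0 < (ω n).2) {n : ℕ} {s : ℝ} (h1 : jumpTime ω n ≤ s) (h2 : s < jumpTime ω (n + 1)) :
    walk ω s = jumpChain ω n := by
  have : jumpCount ω s = n := by
    refine IsGreatest.csSup_eq ⟨h1, fun k hk => ?_⟩
    have := (strictMono_jumpTime hω).lt_iff_lt.mp (lt_of_le_of_lt hk h2)
    omega
  rw [walk, this]

/-- The strict inequality is on the left so that the last site is occupied for a positive time
before T, and hence is seen by the local times. -/
lemma exists_jumpTime_lt_le {T : ℝ} (hT : 0 < T) (h : ∃ n, T < jumpTime ω n) :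
    ∃ n, jumpTime ω n < T ∧ T ≤ jumpTime ω (n + 1) := by
  classical
  have h' : ∃ n, T ≤ jumpTime ω n := h.imp fun _ => le_of_lt
  have h0 : Nat.find h' ≠ 0 := by
    intro h0
    have := Nat.find_spec h'
    rw [h0] at this
    simp only [jumpTime, Finset.range_zero, Finset.sum_empty] at this
    linarith
  obtain ⟨m, hm⟩ := Nat.exists_eq_succ_of_ne_zero h0
  refine ⟨m, not_le.mp (Nat.find_min h' (by omega)), ?_⟩
  have := Nat.find_spec h'
  rwa [hm] at this

open Classical in
lemma integral_walk_eq (hω : ∀ n, 0 < (ω n).2) {n : ℕ} {b : ℝ} (h1 : jumpTime ω n ≤ b) (h2 : b ≤ jumpTime ω (n + 1))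
    (z : Fin d → ℤ) :
    ∫ s in jumpTime ω n..b, (if walk ω s = z then (1 : ℝ) else 0) =
      if jumpChain ω n = z then b - jumpTime ω n else 0 := by
  rw [intervalIntegral.integral_of_le h1, ← restrict_Ico_eq_restrict_Ioc]
  rw [setIntegral_congr_fun (g := fun _ => if jumpChain ω n = z then (1 : ℝ) else 0)
    measurableSet_Ico]
  · split_ifs <;> simp [h1]
  · intro s hs
    simp only [walk_eq_jumpChain hω hs.1 (hs.2.trans_le h2)]

open Classical in
lemma intervalIntegrable_walk (ω : ℕ → (Fin d × Bool) × ℝ) (a b : ℝ) (z : Fin d → ℤ) :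
    IntervalIntegrable (fun s => if walk ω s = z then (1 : ℝ) else 0) volume a b := by
  have hw : Measurable (walk ω) :=
    (measurable_of_countable (jumpChain ω)).comp (measurable_jumpCount ω)
  refine (intervalIntegrable_const (c := (1 : ℝ))).mono_fun ?_ (Eventually.of_forall fun s => ?_)
  · exact (Measurable.ite (hw (measurableSet_singleton z)) measurable_const
      measurable_const).aestronglyMeasurable
  · dsimp only
    split_ifs <;> simp

open Classical in
/-- The local times in terms of the jump chain and the holding times. -/
lemma localTime_eq_sum (hω : ∀ n, 0 < (ω n).2) {T : ℝ} {n : ℕ} (h1 : jumpTime ω n < T) (h2 : T ≤ jumpTime ω (n + 1))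
    (z : Fin d → ℤ) :
    localTime ω T z = (∑ k ∈ Finset.range n, if jumpChain ω k = z then (ω k).2 else 0) +
      if jumpChain ω n = z then T - jumpTime ω n else 0 := by
  have h0 : jumpTime ω 0 = 0 := by simp [jumpTime]
  rw [localTime, ← intervalIntegral.integral_add_adjacent_intervals
    (intervalIntegrable_walk ω 0 (jumpTime ω n) z) (intervalIntegrable_walk ω _ T z),
    integral_walk_eq hω h1.le h2]
  congr 1
  have := intervalIntegral.sum_integral_adjacent_intervals (a := jumpTime ω) (n := n)
    (f := fun s => if walk ω s = z then (1 : ℝ) else 0) (μ := volume)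
    (fun k _ => intervalIntegrable_walk ω _ _ z)
  rw [h0] at this
  rw [← this]
  refine Finset.sum_congr rfl fun k _ => ?_
  rw [integral_walk_eq hω ((strictMono_jumpTime hω).monotone k.le_succ) le_rfl, jumpTime_succ,
    add_sub_cancel_left]

/-- A single term of the series suffices, the one whose n is the number of jumps before T. Every
site visited up to then has positive local time, hence lies in `B`, so no stay factor is killed.
Grouping the stays by site turns the product of exponentials into the exponential of ∑ V ℓ_T, and
the final factor u is at least δ. -/
lemma exp_sum_potential_le_tsum_stoppedValue (hω : ∀ n, 0 < (ω n).2) {T : ℝ} (hT : 0 < T)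
    (hex : ∃ n, T < jumpTime ω n) {B : Finset (Fin d → ℤ)}
    (hB : ∀ z, localTime ω T z ≠ 0 → z ∈ B) (κ : ℝ) {u : (Fin d → ℤ) → ℝ} {δ : ℝ} (hδ : 0 < δ)
    (hu : ∀ z ∈ B, δ ≤ u z) :
    ENNReal.ofReal (Real.exp (∑ z ∈ B, potential κ u z * localTime ω T z)) * ENNReal.ofReal δ ≤
      ∑' n, stoppedValue κ u T n ω := by
  classical
  obtain ⟨n, h1, h2⟩ := exists_jumpTime_lt_le hT hex
  have hloc := localTime_eq_sum hω h1 h2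
  have hnn : ∀ z, 0 ≤ ∑ k ∈ Finset.range n, if jumpChain ω k = z then (ω k).2 else 0 :=
    fun z => Finset.sum_nonneg fun k _ => by split_ifs <;> [exact (hω k).le; exact le_rfl]
  have hlast : jumpChain ω n ∈ B := by
    refine hB _ ?_
    rw [hloc, if_pos rfl]
    have := hnn (jumpChain ω n)
    linarith
  have hmem : ∀ k ∈ Finset.range n, jumpChain ω k ∈ B := by
    intro k hk
    refine hB _ (ne_of_gt ?_)
    rw [hloc]
    have hk' := Finset.single_le_sum (f := fun j => if jumpChain ω j = jumpChain ω k then (ω j).2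
      else 0) (fun j _ => by split_ifs <;> [exact (hω j).le; exact le_rfl]) hk
    simp only [if_true] at hk'
    have := hω k
    split_ifs <;> linarith
  have hsum : ∑ z ∈ B, potential κ u z * localTime ω T z =
      (∑ k ∈ Finset.range n, potential κ u (jumpChain ω k) * (ω k).2) +
        potential κ u (jumpChain ω n) * (T - jumpTime ω n) := by
    simp_rw [hloc, mul_add, Finset.sum_add_distrib, Finset.mul_sum]
    rw [Finset.sum_comm]
    congr 1
    · refine Finset.sum_congr rfl fun k hk => ?_
      simp [mul_ite, hmem k hk]
    · simp [mul_ite, hlast]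
  have hne : ∀ z ∈ B, u z ≠ 0 := fun z hz => (hδ.trans_le (hu z hz)).ne'
  have hweight : pathWeight κ u ω n = ENNReal.ofReal
      (Real.exp (∑ k ∈ Finset.range n, potential κ u (jumpChain ω k) * (ω k).2)) := by
    rw [Real.exp_sum, ENNReal.ofReal_prod_of_nonneg fun k _ => (Real.exp_pos _).le]
    exact Finset.prod_congr rfl fun k hk => by rw [stayFactor, if_neg (hne _ (hmem k hk))]
  refine le_trans ?_ (ENNReal.le_tsum n)
  rw [stoppedValue, if_pos ⟨h1, h2⟩, hweight, stayFactor, if_neg (hne _ hlast), ← mul_assoc,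
    ← ENNReal.ofReal_mul (Real.exp_pos _).le (q := Real.exp (_ * (T - _))), ← Real.exp_add, ← hsum]
  gcongr
  exact hu _ hlast

/-! ### The lattice box and the Dirichlet form -/

/-- The lattice points of the cube `[-R a, R a]^d`. -/
def boxSites (d : ℕ) (R a : ℝ) : Finset (Fin d → ℤ) :=
  Fintype.piFinset fun _ => Finset.Icc ⌈-(R * a)⌉ ⌊R * a⌋

lemma IsBoxProb.mem_boxSites {R a : ℝ} (ha : 0 < a) {μ : (Fin d → ℤ) → ℝ}
    (h : IsBoxProb d R a μ) {z : Fin d → ℤ} (hz : μ z ≠ 0) : z ∈ boxSites d R a := by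
  -- The lower corner z/a of the cell of z already lies in the support, so testing this one point is
  -- enough.
  have hx : (fun i => (z i : ℝ) / a) ∈ cube d R := by
    refine h.support (subset_tsupport _ ?_)
    have : (fun i => ⌊a * ((z i : ℝ) / a)⌋) = z := by
      funext i
      rw [mul_div_cancel₀ _ ha.ne', Int.floor_intCast]
    rw [Function.mem_support, rescale, this]
    exact mul_ne_zero (by positivity) hz
  rw [boxSites, Fintype.mem_piFinset]
  intro i
  have h1 := hx.1 i
  have h2 := hx.2 i
  simp only at h1 h2
  rw [le_div_iff₀ ha] at h1
  rw [div_le_iff₀ ha] at h2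
  rw [Finset.mem_Icc, Int.ceil_le, Int.le_floor]
  exact ⟨by linarith, h2⟩

lemma card_boxSites_le (d : ℕ) {R a : ℝ} (h : 0 ≤ R * a) :
    ((boxSites d R a).card : ℝ) ≤ (2 * (R * a) + 1) ^ d := by
  rw [boxSites, Fintype.card_piFinset, Finset.prod_const, Finset.card_univ, Fintype.card_fin,
    Int.card_Icc, Int.ceil_neg]
  push_cast
  gcongr
  have h0 : 0 ≤ ⌊R * a⌋ := Int.floor_nonneg.mpr h
  have h1 : (((⌊R * a⌋ + 1 - -⌊R * a⌋).toNat : ℤ) : ℝ) = ((⌊R * a⌋ + 1 - -⌊R * a⌋ : ℤ) : ℝ) := by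
    rw [Int.toNat_of_nonneg (by omega)]
  rw [Int.cast_natCast] at h1
  rw [h1]
  push_cast
  linarith [Int.floor_le (R * a)]

lemma card_steps (d : ℕ) : (Fintype.card (Fin d × Bool) : ℝ) = 2 * d := by
  simp only [Fintype.card_prod, Fintype.card_fin, Fintype.card_bool]
  push_cast
  ring

/-- The Dirichlet form of the square root of a finitely supported probability measure. -/
lemma dirichletForm_eq {μ : (Fin d → ℤ) → ℝ} (h0 : ∀ z, 0 ≤ μ z) (h1 : HasSum μ 1)
    {B : Finset (Fin d → ℤ)} (hB : ∀ z, μ z ≠ 0 → z ∈ B) :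
    dirichletForm μ = 2 * d - ∑ x ∈ B, √(μ x) * ∑ s, √(μ (x + unitStep s)) := by
  -- Expand the square: translation by a unit vector preserves the total mass 1, and the cross term
  -- vanishes off `B` through its factor √μ(x).
  have hs : ∀ s : Fin d × Bool, HasSum (fun x => (√(μ x) - √(μ (x + unitStep s))) ^ 2)
      (1 + 1 - 2 * ∑ x ∈ B, √(μ x) * √(μ (x + unitStep s))) := by
    intro s
    have ha : HasSum (fun x => μ (x + unitStep s)) 1 :=
      (Equiv.addRight (unitStep s)).hasSum_iff.mpr h1
    have hb : HasSum (fun x => √(μ x) * √(μ (x + unitStep s)))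
        (∑ x ∈ B, √(μ x) * √(μ (x + unitStep s))) := by
      refine hasSum_sum_of_ne_finset_zero fun x hx => ?_
      have : μ x = 0 := by
        by_contra hne
        exact hx (hB x hne)
      simp [this]
    refine ((h1.add ha).sub (hb.mul_left 2)).congr_fun fun x => ?_
    rw [sub_sq, Real.sq_sqrt (h0 _), Real.sq_sqrt (h0 _)]
    ring
  simp_rw [Finset.mul_sum]
  rw [dirichletForm, (hasSum_sum fun s _ => hs s).tsum_eq, Finset.sum_sub_distrib,
    ← Finset.mul_sum, Finset.sum_comm, Finset.sum_const, Finset.card_univ, nsmul_eq_mul,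
    card_steps]
  ring

/-! ### Discretising the Donsker–Varadhan test function -/

/-- The functions on `B` with values in `{1 / n, …, (n + 1) / n}`, extended by zero. -/
def gridFunction (B : Finset (Fin d → ℤ)) (n : ℕ) (φ : B → Fin (n + 1)) (z : Fin d → ℤ) : ℝ :=
  if h : z ∈ B then ((φ ⟨z, h⟩ : ℕ) + 1) / n else 0

lemma gridFunction_nonneg (B : Finset (Fin d → ℤ)) (n : ℕ) (φ : B → Fin (n + 1))
    (z : Fin d → ℤ) : 0 ≤ gridFunction B n φ z := by
  rw [gridFunction]
  split_ifs <;> positivity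

lemma one_div_le_gridFunction {B : Finset (Fin d → ℤ)} (n : ℕ) (φ : B → Fin (n + 1))
    {z : Fin d → ℤ} (hz : z ∈ B) : 1 / (n : ℝ) ≤ gridFunction B n φ z := by
  rw [gridFunction, dif_pos hz]
  gcongr
  linarith [Nat.cast_nonneg (α := ℝ) (φ ⟨z, hz⟩ : ℕ)]

lemma gridFunction_le (B : Finset (Fin d → ℤ)) (n : ℕ) (φ : B → Fin (n + 1))
    (z : Fin d → ℤ) : gridFunction B n φ z ≤ ((n : ℝ) + 1) / n := by
  rw [gridFunction]
  split_ifs with h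
  · gcongr
    exact_mod_cast Nat.lt_succ_iff.mp (φ ⟨z, h⟩).2
  · positivity

/-- Up to a small error, the Donsker–Varadhan supremum is attained on the grid. -/
lemma exists_grid_dirichletForm_le {κ : ℝ} (hκ : 0 < κ) {μ : (Fin d → ℤ) → ℝ}
    (h0 : ∀ z, 0 ≤ μ z) (h1 : HasSum μ 1) {B : Finset (Fin d → ℤ)} (hB : ∀ z, μ z ≠ 0 → z ∈ B)
    {n : ℕ} (hn : 0 < n) :
    ∃ φ : B → Fin (n + 1), κ * dirichletForm μ ≤
      ∑ z ∈ B, potential κ (gridFunction B n φ) z * μ z + 2 * d * κ * B.card / n := by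
  have hn' : (0 : ℝ) < n := by exact_mod_cast hn
  have hle : ∀ z, √(μ z) ≤ 1 := fun z => by
    rw [Real.sqrt_le_one]
    exact le_hasSum h1 z fun j _ => h0 j
  have hfl : ∀ z, ⌊n * √(μ z)⌋₊ < n + 1 := fun z => by
    rw [Nat.lt_succ_iff]
    refine Nat.floor_le_of_le ?_
    have := mul_le_mul_of_nonneg_left (hle z) hn'.le
    linarith
  -- The floor, together with the + 1 in `gridFunction`, rounds up: √μ ≤ u ≤ √μ + 1/n on `B`, with u
  -- ≥ 1/n even where μ vanishes.
  let φ : B → Fin (n + 1) := fun z => ⟨⌊n * √(μ z)⌋₊, hfl z⟩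
  refine ⟨φ, ?_⟩
  set u := gridFunction B n φ with hu
  have hlow : ∀ z ∈ B, √(μ z) ≤ u z := by
    intro z hz
    rw [hu, gridFunction, dif_pos hz, le_div_iff₀ hn', mul_comm]
    exact (Nat.lt_floor_add_one _).le
  have hup : ∀ z, u z ≤ √(μ z) + 1 / n := by
    intro z
    rw [hu, gridFunction]
    split_ifs with hz
    · rw [add_div]
      gcongr
      rw [div_le_iff₀ hn', mul_comm]
      exact Nat.floor_le (by positivity)
    · positivity
  have hpos : ∀ z ∈ B, 0 < u z := fun z hz =>
    lt_of_lt_of_le (by positivity) (one_div_le_gridFunction n φ hz)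
  have hsumB : ∑ z ∈ B, μ z = 1 := by
    refine (hasSum_sum_of_ne_finset_zero fun z hz => ?_).unique h1
    by_contra hne
    exact hz (hB z hne)
  have hterm : ∀ z ∈ B, (∑ s, u (z + unitStep s)) / u z * μ z ≤
      √(μ z) * ∑ s, √(μ (z + unitStep s)) + 2 * d / n := by
    intro z hz
    -- This is why rounding must go upwards: the quotient stays controlled however small u is, and
    -- the mesh error enters only through the neighbours in the numerator.
    have hquot : μ z / u z ≤ √(μ z) := by
      rw [div_le_iff₀ (hpos z hz)]
      calc μ z = √(μ z) * √(μ z) := (Real.mul_self_sqrt (h0 z)).symm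
        _ ≤ √(μ z) * u z := by
          gcongr
          exact hlow z hz
    calc (∑ s, u (z + unitStep s)) / u z * μ z = (μ z / u z) * ∑ s, u (z + unitStep s) := by ring
      _ ≤ √(μ z) * ∑ s : Fin d × Bool, (√(μ (z + unitStep s)) + 1 / n) := by
          gcongr with s
          · exact Finset.sum_nonneg fun s _ => gridFunction_nonneg B n φ _
          · exact hup _
      _ = √(μ z) * ∑ s, √(μ (z + unitStep s)) + √(μ z) * (2 * d / n) := by
          rw [Finset.sum_add_distrib, Finset.sum_const, Finset.card_univ, nsmul_eq_mul,
            card_steps]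
          ring
      _ ≤ √(μ z) * ∑ s, √(μ (z + unitStep s)) + 2 * d / n := by
          gcongr
          exact mul_le_of_le_one_left (by positivity) (hle z)
  have htot := Finset.sum_le_sum hterm
  rw [Finset.sum_add_distrib, Finset.sum_const, nsmul_eq_mul] at htot
  have hpot : ∑ z ∈ B, potential κ u z * μ z =
      2 * d * κ - κ * ∑ z ∈ B, (∑ s, u (z + unitStep s)) / u z * μ z := by
    rw [Finset.mul_sum]
    calc ∑ z ∈ B, potential κ u z * μ z
        = ∑ z ∈ B, (2 * d * κ * μ z - κ * ((∑ s, u (z + unitStep s)) / u z * μ z)) :=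
          Finset.sum_congr rfl fun z _ => by rw [potential]; ring
      _ = _ := by rw [Finset.sum_sub_distrib, ← Finset.mul_sum, hsumB, mul_one]
  rw [hpot, dirichletForm_eq h0 h1 hB]
  have := mul_le_mul_of_nonneg_left htot hκ.le
  have e : κ * (2 * d / n * B.card) = 2 * d * κ * B.card / n := by ring
  nlinarith [this, e]

/-! ### Union bound over the grid -/

/-- The exponential moment bound at a fixed time. -/
lemma expMoment_le [NeZero d] {R κ a T c : ℝ} (hκ : 0 < κ) (ha : 0 < a) (hT : 0 < T)
    {F : ProbDensity d R → ℝ} (hc : (c : EReal) ≤ chiDiscrete F κ a) {n : ℕ} (hn : T ≤ n) :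
    expMoment F κ a T ≤ ENNReal.ofReal (Real.exp (-(c * (T / a ^ 2)) +
      2 * d * κ * (boxSites d R a).card +
        ((boxSites d R a).card + 1) * Real.log ((n : ℝ) + 1))) := by
  classical
  set B := boxSites d R a
  have hn' : (0 : ℝ) < n := hT.trans_le hn
  have hn0 : 0 < n := by exact_mod_cast hn'
  set K := ENNReal.ofReal (Real.exp (-(c * (T / a ^ 2)) + 2 * d * κ * B.card)) with hK
  have hpoint : ∀ᵐ ω ∂(walkLaw d κ),
      (if tsupport (rescaledLocalTime a T ω) ⊆ cube d R then
        ENNReal.ofReal (Real.exp (T / a ^ 2 * evalDensity F (rescaledLocalTime a T ω))) else 0) ≤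
      K * ∑ φ : B → Fin (n + 1), (n : ℝ≥0∞) * ∑' k, stoppedValue κ (gridFunction B n φ) T k ω := by
    filter_upwards [ae_walkLaw_pos d hκ, ae_walkLaw_exists_lt_jumpTime d hκ T] with ω hω hex
    split_ifs with hsupp
    swap
    · exact zero_le
    obtain ⟨hl0, hl1⟩ := hasSum_localTime ω hT.le
    set μ : (Fin d → ℤ) → ℝ := fun z => localTime ω T z / T with hμ
    have hbox : IsBoxProb d R a μ := by
      refine ⟨fun z => div_nonneg (hl0 z) hT.le, ?_, hsupp⟩
      have := hl1.div_const T
      rwa [div_self hT.ne'] at this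
    have hmem : ∀ z, μ z ≠ 0 → z ∈ B := fun z hz => hbox.mem_boxSites ha hz
    have hcF : c ≤ a ^ 2 * (κ * dirichletForm μ) - evalDensity F (rescale a μ) :=
      EReal.coe_le_coe_iff.mp (hc.trans (iInf₂_le μ hbox))
    obtain ⟨φ, hφ⟩ := exists_grid_dirichletForm_le hκ hbox.nonneg hbox.hasSum hmem hn0
    set u := gridFunction B n φ with hu
    have hexp : T / a ^ 2 * evalDensity F (rescaledLocalTime a T ω) ≤
        (-(c * (T / a ^ 2)) + 2 * d * κ * B.card) + ∑ z ∈ B, potential κ u z * localTime ω T z := by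
      have h1 : T / a ^ 2 * evalDensity F (rescale a μ) ≤
          T / a ^ 2 * (a ^ 2 * (κ * dirichletForm μ) - c) := by
        gcongr
        linarith
      have h2 : T / a ^ 2 * (a ^ 2 * (κ * dirichletForm μ) - c) =
          T * (κ * dirichletForm μ) - c * (T / a ^ 2) := by
        field_simp
      have h3 := mul_le_mul_of_nonneg_left hφ hT.le
      have h4 : T * ∑ z ∈ B, potential κ u z * μ z =
          ∑ z ∈ B, potential κ u z * localTime ω T z := by
        rw [Finset.mul_sum]
        refine Finset.sum_congr rfl fun z _ => ?_
        rw [hμ]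
        field_simp
      -- The choice n ≥ T keeps the discretisation error, multiplied by T, bounded by a multiple of
      -- |B|.
      have h5 : T * (2 * d * κ * B.card / n) ≤ 2 * d * κ * B.card := by
        rw [mul_div_assoc', div_le_iff₀ hn', mul_comm]
        gcongr
      rw [mul_add, h4] at h3
      change T / a ^ 2 * evalDensity F (rescale a μ) ≤ _
      linarith
    have hfk := exp_sum_potential_le_tsum_stoppedValue hω hT hex
      (fun z hz => hmem z (div_ne_zero hz hT.ne')) κ (u := u) (δ := 1 / n) (by positivity)
      (fun z hz => one_div_le_gridFunction n φ hz)
    -- The prefactor n compensates the lower bound δ = 1/n on the terminal value of u.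
    have hcancel : (n : ℝ≥0∞) * ENNReal.ofReal (1 / n) = 1 := by
      rw [← ENNReal.ofReal_natCast, ← ENNReal.ofReal_mul hn'.le, mul_one_div_cancel hn'.ne',
        ENNReal.ofReal_one]
    calc ENNReal.ofReal (Real.exp (T / a ^ 2 * evalDensity F (rescaledLocalTime a T ω)))
        ≤ K * ENNReal.ofReal (Real.exp (∑ z ∈ B, potential κ u z * localTime ω T z)) := by
          rw [hK, ← ENNReal.ofReal_mul (Real.exp_pos _).le, ← Real.exp_add]
          exact ENNReal.ofReal_le_ofReal (Real.exp_le_exp.mpr hexp)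
      _ = K * (n * (ENNReal.ofReal (Real.exp (∑ z ∈ B, potential κ u z * localTime ω T z)) *
            ENNReal.ofReal (1 / n))) := by
          rw [mul_left_comm (n : ℝ≥0∞), hcancel, mul_one]
      _ ≤ K * (n * ∑' k, stoppedValue κ u T k ω) := by gcongr
      _ ≤ _ := by
          gcongr
          exact Finset.single_le_sum (f := fun φ : B → Fin (n + 1) =>
            (n : ℝ≥0∞) * ∑' k, stoppedValue κ (gridFunction B n φ) T k ω)
            (fun _ _ => zero_le) (Finset.mem_univ φ)
  have hmeas : ∀ φ : B → Fin (n + 1),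
      Measurable fun ω => ∑' k, stoppedValue κ (gridFunction B n φ) T k ω := fun φ =>
    Measurable.tsum fun k => measurable_stoppedValue κ _ T k
  calc expMoment F κ a T
      ≤ ∫⁻ ω, K * ∑ φ : B → Fin (n + 1), (n : ℝ≥0∞) *
          ∑' k, stoppedValue κ (gridFunction B n φ) T k ω ∂(walkLaw d κ) := lintegral_mono_ae hpoint
    _ = K * ∑ φ : B → Fin (n + 1), (n : ℝ≥0∞) *
          ∫⁻ ω, ∑' k, stoppedValue κ (gridFunction B n φ) T k ω ∂(walkLaw d κ) := by
        rw [lintegral_const_mul _ (Finset.measurable_fun_sum _ fun φ _ => (hmeas φ).const_mul _),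
          lintegral_finsetSum _ fun φ _ => (hmeas φ).const_mul _]
        congr 1
        exact Finset.sum_congr rfl fun φ _ => lintegral_const_mul _ (hmeas φ)
    -- Each grid function costs n u(0) ≤ n + 1. With (n+1)^|B| of them, the exponent |B| + 1
    -- results.
    _ ≤ K * ∑ _φ : B → Fin (n + 1), ((n + 1 : ℕ) : ℝ≥0∞) := by
        gcongr with φ
        calc (n : ℝ≥0∞) * ∫⁻ ω, ∑' k, stoppedValue κ (gridFunction B n φ) T k ω ∂(walkLaw d κ)
            ≤ n * ENNReal.ofReal (((n : ℝ) + 1) / n) := by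
              gcongr
              exact (lintegral_tsum_stoppedValue_le hκ (gridFunction_nonneg B n φ) T).trans
                (ENNReal.ofReal_le_ofReal (gridFunction_le B n φ 0))
          _ = ((n + 1 : ℕ) : ℝ≥0∞) := by
              rw [← ENNReal.ofReal_natCast n, ← ENNReal.ofReal_mul hn'.le,
                mul_div_cancel₀ _ hn'.ne', ← ENNReal.ofReal_natCast (n + 1)]
              push_cast
              rfl
    _ = ENNReal.ofReal (Real.exp (-(c * (T / a ^ 2)) + 2 * d * κ * B.card +
          (B.card + 1) * Real.log ((n : ℝ) + 1))) := by
        have hpow : Real.exp ((B.card + 1) * Real.log ((n : ℝ) + 1)) =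
            ((n + 1 : ℕ) : ℝ) ^ (B.card + 1) := by
          rw [← Real.rpow_natCast, Real.rpow_def_of_pos (by positivity)]
          push_cast
          ring_nf
        rw [Real.exp_add _ (_ * Real.log _), ENNReal.ofReal_mul (Real.exp_pos _).le, hpow,
          ENNReal.ofReal_pow (by positivity), ENNReal.ofReal_natCast, Finset.sum_const,
          Finset.card_univ, Fintype.card_fun, Fintype.card_fin, Fintype.card_coe, nsmul_eq_mul,
          Nat.cast_pow, pow_succ (_ : ℝ≥0∞)]

/-! ### Asymptotics of the error term -/

lemma tendsto_pow_mul_log_div {d : ℕ} {α : ℝ → ℝ}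
    (hα : α =o[atTop] fun T : ℝ => (T / Real.log T) ^ ((1 : ℝ) / ((d : ℝ) + 2))) :
    Tendsto (fun T => α T ^ (d + 2) * Real.log T / T) atTop (𝓝 0) := by
  have h := hα.tendsto_div_nhds_zero.pow (d + 2)
  rw [zero_pow (by omega)] at h
  refine h.congr' ?_
  filter_upwards [eventually_gt_atTop 1] with T hT
  have hlog := Real.log_pos hT
  have hbase : 0 ≤ T / Real.log T := by positivity
  have hexp : ((T / Real.log T) ^ ((1 : ℝ) / ((d : ℝ) + 2))) ^ (d + 2) = T / Real.log T := by
    rw [← Real.rpow_natCast, ← Real.rpow_mul hbase]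
    push_cast
    rw [one_div_mul_cancel (by positivity), Real.rpow_one]
  rw [div_pow, hexp]
  field_simp

/-- The fixed-time bound is used with n = ⌈T⌉. Once α ≥ 1, the box has at most (2R+1)^d α^d sites,
and all error terms merge into one multiple of α^d log T. -/
lemma eventually_scaled_log_expMoment_le {d : ℕ} [NeZero d] {κ R : ℝ} (hκ : 0 < κ) (hR : 0 < R)
    {α : ℝ → ℝ} (hα_top : Tendsto α atTop atTop) {F : ProbDensity d R → ℝ} {c : ℝ}
    (hc : ∀ᶠ T in atTop, (c : EReal) < chiDiscrete F κ (α T)) :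
    ∀ᶠ T in atTop, ((α T ^ 2 / T : ℝ) : EReal) * ENNReal.log (expMoment F κ (α T) T) ≤
      ((-c + (2 * d * κ + 4) * (2 * R + 1) ^ d * (α T ^ (d + 2) * Real.log T / T) : ℝ) : EReal) := by
  filter_upwards [hc, hα_top.eventually_ge_atTop 1, eventually_ge_atTop (3 : ℝ)] with T hcT ha hT
  set a := α T with ha_def
  have ha0 : 0 < a := by linarith
  have hT0 : 0 < T := by linarith
  have hmain := expMoment_le hκ ha0 hT0 hcT.le (Nat.le_ceil T)
  set b : ℝ := ((boxSites d R a).card : ℝ) with hb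
  set m : ℝ := (⌈T⌉₊ : ℝ) with hm
  have hlogT : 1 ≤ Real.log T := by
    rw [Real.le_log_iff_exp_le hT0]
    linarith [Real.exp_one_lt_d9]
  -- Here m + 1 < T + 2 ≤ T², which T ≥ 3 guarantees.
  have hlogm : Real.log (m + 1) ≤ 2 * Real.log T := by
    rw [← Real.log_rpow hT0]
    have h1 : m < T + 1 := Nat.ceil_lt_add_one hT0.le
    have h2 : T ≤ m := Nat.le_ceil T
    refine Real.log_le_log (by linarith) ?_
    rw [Real.rpow_two]
    nlinarith
  have hb0 : 0 ≤ b := Nat.cast_nonneg _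
  set C := (2 * R + 1) ^ d with hC
  have hC1 : 1 ≤ C := one_le_pow₀ (by linarith)
  have hbC : b ≤ C * a ^ d := by
    refine (card_boxSites_le d (by positivity)).trans ?_
    rw [hC, ← mul_pow]
    gcongr
    linarith
  have h1C : 1 ≤ C * a ^ d := one_le_mul_of_one_le_of_one_le hC1 (one_le_pow₀ ha)
  have hlogm0 : 0 ≤ Real.log (m + 1) := Real.log_nonneg (by
    linarith [show (0 : ℝ) ≤ m from Nat.cast_nonneg _])
  have herr : 2 * d * κ * b + (b + 1) * Real.log (m + 1) ≤
      (2 * d * κ + 4) * C * (a ^ d * Real.log T) := by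
    have h1 : 2 * d * κ * b ≤ 2 * d * κ * (C * a ^ d * Real.log T) := by
      gcongr
      exact hbC.trans (le_mul_of_one_le_right (by positivity) hlogT)
    have h2 : (b + 1) * Real.log (m + 1) ≤ (2 * (C * a ^ d)) * (2 * Real.log T) := by
      gcongr
      linarith
    calc _ ≤ 2 * d * κ * (C * a ^ d * Real.log T) + (2 * (C * a ^ d)) * (2 * Real.log T) :=
          add_le_add h1 h2
      _ = _ := by ring
  have hlog : ENNReal.log (expMoment F κ a T) ≤
      ((-(c * (T / a ^ 2)) + 2 * d * κ * b + (b + 1) * Real.log (m + 1) : ℝ) : EReal) := by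
    refine (ENNReal.log_monotone hmain).trans ?_
    rw [ENNReal.log_ofReal_of_pos (Real.exp_pos _), Real.log_exp]
  calc ((a ^ 2 / T : ℝ) : EReal) * ENNReal.log (expMoment F κ a T)
      ≤ ((a ^ 2 / T : ℝ) : EReal) *
        ((-(c * (T / a ^ 2)) + 2 * d * κ * b + (b + 1) * Real.log (m + 1) : ℝ) : EReal) :=
        mul_le_mul_of_nonneg_left hlog (EReal.coe_nonneg.mpr (by positivity))
    _ ≤ _ := by
        rw [← EReal.coe_mul, EReal.coe_le_coe_iff]
        have h := mul_le_mul_of_nonneg_left herr (show 0 ≤ a ^ 2 / T by positivity)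
        have e1 : a ^ 2 / T * (c * (T / a ^ 2)) = c := by field_simp
        have e2 : a ^ 2 / T * ((2 * d * κ + 4) * C * (a ^ d * Real.log T)) =
            (2 * d * κ + 4) * C * (a ^ (d + 2) * Real.log T / T) := by
          ring
        rw [e2] at h
        linarith [mul_add (a ^ 2 / T) (-(c * (T / a ^ 2)) + 2 * d * κ * b)
          ((b + 1) * Real.log (m + 1)), mul_add (a ^ 2 / T) (-(c * (T / a ^ 2))) (2 * d * κ * b),
          mul_add (a ^ 2 / T) (2 * d * κ * b) ((b + 1) * Real.log (m + 1)),
          mul_neg (a ^ 2 / T) (c * (T / a ^ 2))]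

end RescaledLocalTimes

end

theorem theorem3p7 (d : ℕ) [NeZero d] (κ : ℝ) (hκ : 0 < κ) (R : ℝ) (hR : 0 < R)
    (α : ℝ → ℝ) (hα_top : Tendsto α atTop atTop)
    (hα_small : α =o[atTop] fun T : ℝ => (T / Real.log T) ^ ((1 : ℝ) / ((d : ℝ) + 2)))
    (F : RescaledLocalTimes.ProbDensity d R → ℝ)
    (hF : Measurable[borel (RescaledLocalTimes.ProbDensity d R)] F)
    (hliminf : RescaledLocalTimes.chi F ≤
      liminf (fun T : ℝ => RescaledLocalTimes.chiDiscrete F κ (α T)) atTop) :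
    limsup (fun T : ℝ => ((α T ^ 2 / T : ℝ) : EReal) *
        ENNReal.log (RescaledLocalTimes.expMoment F κ (α T) T)) atTop ≤
      -RescaledLocalTimes.chi F := by
  -- Testing against real z > -χ treats finite and infinite χ alike; c = -z is then a real number
  -- below χ, hence eventually below the discrete infimum.
  refine EReal.le_of_forall_lt_iff_le.mp fun z hz => ?_
  have hz' : ((-z : ℝ) : EReal) < RescaledLocalTimes.chi F := by
    rw [EReal.coe_neg]
    exact EReal.neg_lt_of_neg_lt hz
  have hev := eventually_lt_of_lt_liminf (hz'.trans_le hliminf)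
  have hlim : Tendsto (fun T => ((-(-z) + (2 * d * κ + 4) * (2 * R + 1) ^ d *
      (α T ^ (d + 2) * Real.log T / T) : ℝ) : EReal)) atTop (𝓝 (z : EReal)) := by
    refine (continuous_coe_real_ereal.tendsto z).comp ?_
    simpa using ((RescaledLocalTimes.tendsto_pow_mul_log_div hα_small).const_mul
      ((2 * d * κ + 4) * (2 * R + 1) ^ d)).const_add (-(-z))
  rw [← hlim.limsup_eq]
  exact limsup_le_limsup (RescaledLocalTimes.eventually_scaled_log_expMoment_le hκ hR hα_top hev)
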